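/- Let $U\subseteq\mathbb R^3$ be an open set with coordinates $(x_1,x_2,x_3)$ (for instance $U=\mathbb R^3$), let $\lambda_i=\lambda_i(x_i)$, $i=1,2,3$, be smooth real functions of one variable with $\lambda_i(x_i)\neq\lambda_j(x_j)$ for $i\ne j$ at all points of $U$, and let $f:U\to\mathbb R$ be a smooth function with $f_{x_1},f_{x_2},f_{x_3}$ nowhere zero on $U$. Put $$g=\frac{(\lambda_2-\lambda_3)^2f_{x_1}}{f_{x_2}f_{x_3}}dx_1^2+\frac{(\lambda_1-\lambda_3)^2f_{x_2}}{f_{x_1}f_{x_3}}dx_2^2+\frac{(\lambda_1-\lambda_2)^2f_{x_3}}{f_{x_1}f_{x_2}}dx_3^2+\frac{2(\lambda_1-\lambda_3)(\lambda_2-\lambda_3)}{f_{x_3}}dx_1dx_2+\frac{2(\lambda_1-\lambda_2)(\lambda_3-\lambda_2)}{f_{x_2}}dx_1dx_3+\frac{2(\lambda_2-\lambda_1)(\lambda_3-\lambda_1)}{f_{x_1}}dx_2dx_3$$ and $\omega=\omega_1dx_1+\omega_2dx_2+\omega_3dx_3$, where for $\{i,j,k\}=\{1,2,3\}$ $$\omega_i=\Bigl(\frac1{\lambda_i-\lambda_j}+\frac1{\lambda_i-\lambda_k}\Bigr)\lambda_i'-\frac1{\lambda_i-\lambda_j}\frac{f_{x_i}}{f_{x_j}}\lambda_j'-\frac1{\lambda_i-\lambda_k}\frac{f_{x_i}}{f_{x_k}}\lambda_k'-\frac{f_{x_ix_i}}{f_{x_i}}.$$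 Then $(g,\omega)$ defines a Weyl structure on $U$: $g$ is a smooth pseudo-Riemannian metric (a nondegenerate symmetric 2-tensor) on $U$, $\omega$ is a smooth 1-form on $U$, and there is a unique smooth torsion-free affine connection $\nabla$ on $U$ with $\nabla g=\omega\otimes g$. This Weyl structure is Einstein–Weyl, i.e. the symmetrized Ricci tensor of $\nabla$ equals $\Lambda g$ for some function $\Lambda$ on $U$, if and only if $f$ satisfies on $U$ the equation $$(\lambda_2-\lambda_3)f_{x_1}f_{x_2x_3}+(\lambda_3-\lambda_1)f_{x_2}f_{x_3x_1}+(\lambda_1-\lambda_2)f_{x_3}f_{x_1x_2}=0.\qquad\text{(A)}$$ -/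

import Mathlib

open scoped ContDiff

noncomputable section

namespace WeylGeom

/-- The coordinate space with coordinates `x 0, x 1, x 2` (standing for x₁, x₂, x₃). -/
abbrev Space : Type := Fin 3 → ℝ

/-- The partial derivative of `f` with respect to the `i`-th coordinate. -/
def pd (i : Fin 3) (f : Space → ℝ) (x : Space) : ℝ :=
  fderiv ℝ f x (Pi.single i 1)

/-- `g` (given by its components `g x i j`) is a smooth pseudo-Riemannian metric on `U`. -/
structure IsMetricOn (U : Set Space) (g : Space → Matrix (Fin 3) (Fin 3) ℝ) : Prop where
  smooth : ∀ i j, ContDiffOn ℝ ∞ (fun x => g x i j) U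
  symm : ∀ x ∈ U, (g x).IsSymm
  nondeg : ∀ x ∈ U, (g x).det ≠ 0

/-- `w` (given by its components `w x i`) is a smooth 1-form on `U`. -/
def IsOneFormOn (U : Set Space) (w : Space → Fin 3 → ℝ) : Prop :=
  ∀ i, ContDiffOn ℝ ∞ (fun x => w x i) U

/-- The Christoffel symbols of an affine connection in the coordinates:
`Γ x k i j` is the `k`-th component of `∇_{∂ᵢ} ∂ⱼ` at `x`. -/
abbrev Christoffel : Type := Space → Fin 3 → Fin 3 → Fin 3 → ℝ

/-- The component `(∇_{∂ₖ} g)(∂ᵢ, ∂ⱼ)` of the covariant derivative of `g`. -/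
def covDerivMetric (Γ : Christoffel) (g : Space → Matrix (Fin 3) (Fin 3) ℝ)
    (x : Space) (k i j : Fin 3) : ℝ :=
  pd k (fun y => g y i j) x - ∑ l, Γ x l k i * g x l j - ∑ l, Γ x l k j * g x i l

/-- The connection `Γ` is smooth and torsion-free on `U` and satisfies `∇g = w ⊗ g` there. -/
structure IsWeylConnection (U : Set Space) (g : Space → Matrix (Fin 3) (Fin 3) ℝ)
    (w : Space → Fin 3 → ℝ) (Γ : Christoffel) : Prop where
  smooth : ∀ k i j, ContDiffOn ℝ ∞ (fun x => Γ x k i j) U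
  torsionFree : ∀ x ∈ U, ∀ k i j, Γ x k i j = Γ x k j i
  compatible : ∀ x ∈ U, ∀ k i j, covDerivMetric Γ g x k i j = w x k * g x i j

/-- The component of `R(∂ᵢ, ∂ⱼ) ∂ₗ = ∇ᵢ ∇ⱼ ∂ₗ - ∇ⱼ ∇ᵢ ∂ₗ` along `∂ₖ`. -/
def curvature (Γ : Christoffel) (x : Space) (k l i j : Fin 3) : ℝ :=
  pd i (fun y => Γ y k j l) x - pd j (fun y => Γ y k i l) x
    + ∑ m, (Γ x k i m * Γ x m j l - Γ x k j m * Γ x m i l)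

/-- The Ricci tensor `Ric(∂ⱼ, ∂ₗ)`, the trace of `X ↦ R(X, ∂ⱼ) ∂ₗ` (in general not symmetric). -/
def ricci (Γ : Christoffel) (x : Space) (j l : Fin 3) : ℝ :=
  ∑ k, curvature Γ x k l k j

/-- The Einstein–Weyl equation: the symmetrized Ricci tensor of the connection is
a function multiple of the metric. -/
def IsEinsteinWeyl (U : Set Space) (g : Space → Matrix (Fin 3) (Fin 3) ℝ)
    (Γ : Christoffel) : Prop :=
  ∃ Λ : Space → ℝ, ∀ x ∈ U, ∀ i j,
    (ricci Γ x i j + ricci Γ x j i) / 2 = Λ x * g x i j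

/-- The metric built from `f` and the functions `lam i` of the single variables `x i`. -/
def webMetric (lam : Fin 3 → ℝ → ℝ) (f : Space → ℝ) (x : Space) :
    Matrix (Fin 3) (Fin 3) ℝ :=
  let l1 := lam 0 (x 0)
  let l2 := lam 1 (x 1)
  let l3 := lam 2 (x 2)
  let f1 := pd 0 f x
  let f2 := pd 1 f x
  let f3 := pd 2 f x
  !![(l2 - l3) ^ 2 * f1 / (f2 * f3), (l1 - l3) * (l2 - l3) / f3, (l1 - l2) * (l3 - l2) / f2;
     (l1 - l3) * (l2 - l3) / f3, (l1 - l3) ^ 2 * f2 / (f1 * f3), (l2 - l1) * (l3 - l1) / f1;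
     (l1 - l2) * (l3 - l2) / f2, (l2 - l1) * (l3 - l1) / f1, (l1 - l2) ^ 2 * f3 / (f1 * f2)]

/-- The 1-form built from `f` and the functions `lam i` of the single variables `x i`. -/
def webForm (lam : Fin 3 → ℝ → ℝ) (f : Space → ℝ) (x : Space) : Fin 3 → ℝ :=
  let l1 := lam 0 (x 0)
  let l2 := lam 1 (x 1)
  let l3 := lam 2 (x 2)
  let l1' := deriv (lam 0) (x 0)
  let l2' := deriv (lam 1) (x 1)
  let l3' := deriv (lam 2) (x 2)
  let f1 := pd 0 f x
  let f2 := pd 1 f x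
  let f3 := pd 2 f x
  ![(1 / (l1 - l2) + 1 / (l1 - l3)) * l1' - (1 / (l1 - l2) * (f1 / f2)) * l2'
      - (1 / (l1 - l3) * (f1 / f3)) * l3' - pd 0 (pd 0 f) x / f1,
    (1 / (l2 - l1) + 1 / (l2 - l3)) * l2' - (1 / (l2 - l1) * (f2 / f1)) * l1'
      - (1 / (l2 - l3) * (f2 / f3)) * l3' - pd 1 (pd 1 f) x / f2,
    (1 / (l3 - l1) + 1 / (l3 - l2)) * l3' - (1 / (l3 - l1) * (f3 / f1)) * l1'
      - (1 / (l3 - l2) * (f3 / f2)) * l2' - pd 2 (pd 2 f) x / f3]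

/-- The deformed Hirota equation, PDE (A), at the point `x`. -/
def PDEA (lam : Fin 3 → ℝ → ℝ) (f : Space → ℝ) (x : Space) : Prop :=
  (lam 1 (x 1) - lam 2 (x 2)) * pd 0 f x * pd 2 (pd 1 f) x
    + (lam 2 (x 2) - lam 0 (x 0)) * pd 1 f x * pd 0 (pd 2 f) x
    + (lam 0 (x 0) - lam 1 (x 1)) * pd 2 f x * pd 1 (pd 0 f) x = 0

end WeylGeom

end

noncomputable section

namespace WeylGeom

/-! ### Partial derivatives on open sets. -/

open Filter Topology

/-! Write fᵢ = ∂ᵢf and work in the frame eᵢ = ∂ᵢ/fᵢ. With αᵢ = λⱼ − λₖ for (i,j,k) cyclic, the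
metric has g(eᵢ,eᵢ) = αᵢ²/(f₁f₂f₃) and g(eᵢ,eⱼ) = −αᵢαⱼ/(f₁f₂f₃). Nondegeneracy is then visible, and
the coordinate surfaces xₖ = const are null: g restricted to the span of eᵢ, eⱼ has kernel spanned
by vₖ = αⱼeᵢ + αᵢeⱼ. In this frame everything becomes rational in the differences `gap`, the scaled
derivatives `slope` of the λᵢ and the scaled Hessian `hess` of f; equation (A) becomes H = 0 for the
alternating expression `hirota`.

The Weyl connection is given by explicit Christoffel symbols. It is checked directly
(`isWeylConnection`) and is unique by the usual Koszul argument. Its symbols Γᵏᵢⱼ with i, j ≠ k are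
multiples of H, so (A) makes the coordinate surfaces totally geodesic.

A symmetric tensor S is proportional to g exactly when S(eᵢ,vₖ) = 0 for all i ≠ k. The central
computation `scaledRicci_relation` expresses S(eᵢ,vₖ), for S the symmetrized Ricci tensor, through H
and its first derivatives, every term containing one of them. If H vanishes on the open set U, so do
its derivatives, and the Einstein–Weyl equation follows. Conversely, the six relations hold at each
point, and a suitable combination eliminates the derivatives of H and leaves a nonzero multiple of
H² equal to zero. -/

theorem contDiffOn_pd {U : Set Space} (hU : IsOpen U) {f : Space → ℝ}
    (hf : ContDiffOn ℝ ∞ f U) (i : Fin 3) : ContDiffOn ℝ ∞ (pd i f) U := by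
  have h : ContDiffOn ℝ ∞ (fderiv ℝ f) U := hf.fderiv_of_isOpen hU (by simp)
  exact h.clm_apply contDiffOn_const

theorem pd_congr {U : Set Space} (hU : IsOpen U) {f g : Space → ℝ}
    (h : ∀ x ∈ U, f x = g x) {x : Space} (hx : x ∈ U) (i : Fin 3) : pd i f x = pd i g x := by
  have : f =ᶠ[𝓝 x] g := Filter.eventuallyEq_of_mem (hU.mem_nhds hx) h
  simp only [pd, this.fderiv_eq]

theorem pd_comm {U : Set Space} (hU : IsOpen U) {f : Space → ℝ}
    (hf : ContDiffOn ℝ ∞ f U) {x : Space} (hx : x ∈ U) (i j : Fin 3) :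
    pd i (pd j f) x = pd j (pd i f) x := by
  have hfx : ContDiffAt ℝ ∞ f x := hf.contDiffAt (hU.mem_nhds hx)
  have hd : DifferentiableAt ℝ (fderiv ℝ f) x :=
    (hfx.fderiv_right (m := 1) (by norm_cast)).differentiableAt (by simp)
  have hs : IsSymmSndFDerivAt ℝ f x :=
    hfx.isSymmSndFDerivAt (by simp; norm_cast)
  have key : ∀ a b : Fin 3, pd a (pd b f) x
      = fderiv ℝ (fderiv ℝ f) x (Pi.single a 1) (Pi.single b 1) := by
    intro a b
    change fderiv ℝ (fun y => fderiv ℝ f y (Pi.single b 1)) x (Pi.single a 1) = _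
    rw [fderiv_clm_apply hd (differentiableAt_const _)]
    simp
  rw [key, key]; exact hs.eq _ _

/-! ### Differentiation along the scaled frame. -/

/-- `F` is differentiable at `x`, with derivative `d` in the direction of the vector
`(1 / ∂ₙ f) ∂ₙ`. -/
def HasScaledPd (f : Space → ℝ) (n : Fin 3) (F : Space → ℝ) (d : ℝ) (x : Space) : Prop :=
  DifferentiableAt ℝ F x ∧ pd n F x = pd n f x * d

namespace HasScaledPd

variable {f : Space → ℝ} {n : Fin 3} {F G : Space → ℝ} {a b : ℝ} {x : Space}

theorem congr_deriv (hF : HasScaledPd f n F a x) (h : a = b) : HasScaledPd f n F b x := h ▸ hF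

theorem const (c : ℝ) : HasScaledPd f n (fun _ => c) 0 x :=
  ⟨differentiableAt_const c, by simp [pd]⟩

theorem add (hF : HasScaledPd f n F a x) (hG : HasScaledPd f n G b x) :
    HasScaledPd f n (fun y => F y + G y) (a + b) x := by
  refine ⟨hF.1.add hG.1, ?_⟩
  have h1 := hF.2; have h2 := hG.2
  simp only [pd] at h1 h2 ⊢
  rw [fderiv_fun_add hF.1 hG.1, _root_.add_apply, h1, h2]; ring

theorem neg (hF : HasScaledPd f n F a x) : HasScaledPd f n (fun y => -F y) (-a) x := by
  refine ⟨hF.1.neg, ?_⟩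
  have h1 := hF.2
  simp only [pd] at h1 ⊢
  rw [fderiv_fun_neg, _root_.neg_apply, h1]; ring

theorem sub (hF : HasScaledPd f n F a x) (hG : HasScaledPd f n G b x) :
    HasScaledPd f n (fun y => F y - G y) (a - b) x := by
  simpa only [sub_eq_add_neg] using hF.add hG.neg

theorem mul (hF : HasScaledPd f n F a x) (hG : HasScaledPd f n G b x) :
    HasScaledPd f n (fun y => F y * G y) (a * G x + F x * b) x := by
  refine ⟨hF.1.mul hG.1, ?_⟩
  have h1 := hF.2; have h2 := hG.2
  simp only [pd] at h1 h2 ⊢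
  rw [fderiv_fun_mul hF.1 hG.1]
  simp only [_root_.add_apply, _root_.smul_apply, smul_eq_mul, h1, h2]
  ring

theorem inv (hF : HasScaledPd f n F a x) (h0 : F x ≠ 0) :
    HasScaledPd f n (fun y => (F y)⁻¹) (-a / F x ^ 2) x := by
  refine ⟨hF.1.inv h0, ?_⟩
  have h1 := hF.2
  simp only [pd] at h1 ⊢
  have : HasFDerivAt (fun y => (F y)⁻¹) (-(F x ^ 2)⁻¹ • fderiv ℝ F x) x :=
    (hasDerivAt_inv h0).comp_hasFDerivAt x hF.1.hasFDerivAt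
  rw [this.fderiv]
  simp only [_root_.smul_apply, smul_eq_mul, h1]
  ring

theorem div (hF : HasScaledPd f n F a x) (hG : HasScaledPd f n G b x) (h0 : G x ≠ 0) :
    HasScaledPd f n (fun y => F y / G y) (a / G x - F x * b / G x ^ 2) x := by
  simp only [div_eq_mul_inv]
  exact (hF.mul (hG.inv h0)).congr_deriv (by ring)

end HasScaledPd

/-! ### The scaled quantities attached to the web. -/

/-- The difference `λᵢ - λⱼ`. -/
def gap (lam : Fin 3 → ℝ → ℝ) (i j : Fin 3) (x : Space) : ℝ := lam i (x i) - lam j (x j)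

/-- The derivative of `λᵢ`, scaled by `1 / ∂ᵢ f`. -/
def slope (lam : Fin 3 → ℝ → ℝ) (f : Space → ℝ) (i : Fin 3) (x : Space) : ℝ :=
  deriv (lam i) (x i) / pd i f x

/-- The second derivative of `λᵢ`, scaled by `1 / (∂ᵢ f)²`. -/
def slope₂ (lam : Fin 3 → ℝ → ℝ) (f : Space → ℝ) (i : Fin 3) (x : Space) : ℝ :=
  deriv (deriv (lam i)) (x i) / pd i f x ^ 2

/-- The second partial derivatives of `f`, scaled by the first ones. -/
def hess (f : Space → ℝ) (i j : Fin 3) (x : Space) : ℝ :=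
  pd (min i j) (pd (max i j) f) x / (pd i f x * pd j f x)

/-- The third partial derivatives of `f`, scaled by the first ones. -/
def hess₃ (f : Space → ℝ) (n i j : Fin 3) (x : Space) : ℝ :=
  pd n (pd (min i j) (pd (max i j) f)) x / (pd n f x * pd i f x * pd j f x)

/-- The left hand side of the deformed Hirota equation, scaled by the first partial derivatives
of `f`; it is alternating in the three indices. -/
def hirota (lam : Fin 3 → ℝ → ℝ) (f : Space → ℝ) (i j k : Fin 3) (x : Space) : ℝ :=
  gap lam j k x * hess f j k x + gap lam k i x * hess f k i x + gap lam i j x * hess f i j x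

theorem gap_swap (lam : Fin 3 → ℝ → ℝ) (i j : Fin 3) (x : Space) :
    gap lam i j x = -gap lam j i x := by simp [gap]

/-- The `min`/`max` in `hess` fixes the order of differentiation, so this symmetry needs no
smoothness of `f`; only `pd_min_max` uses it. -/
theorem hess_comm (f : Space → ℝ) (i j : Fin 3) (x : Space) : hess f i j x = hess f j i x := by
  rw [hess, hess, min_comm, max_comm, mul_comm (pd i f x)]

theorem hess₃_comm_right (f : Space → ℝ) (n i j : Fin 3) (x : Space) :
    hess₃ f n i j x = hess₃ f n j i x := by
  rw [hess₃, hess₃, min_comm, max_comm, mul_right_comm]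

theorem hirota_swap (lam : Fin 3 → ℝ → ℝ) (f : Space → ℝ) (i j k : Fin 3) (x : Space) :
    hirota lam f i j k x = -hirota lam f j i k x := by
  simp only [hirota, gap_swap lam k i, gap_swap lam j i, gap_swap lam k j, hess_comm f k i,
    hess_comm f j i, hess_comm f k j]
  ring

theorem hirota_rotate (lam : Fin 3 → ℝ → ℝ) (f : Space → ℝ) (i j k : Fin 3) (x : Space) :
    hirota lam f i j k x = hirota lam f j k i x := by
  simp only [hirota]; ring

/-- The data of the web: smooth functions `λᵢ` with distinct values and a smooth `f` with
nonvanishing partial derivatives on an open set. -/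
structure IsWeb (U : Set Space) (lam : Fin 3 → ℝ → ℝ) (f : Space → ℝ) : Prop where
  isOpen : IsOpen U
  smooth_lam : ∀ x ∈ U, ∀ i, ContDiffAt ℝ ∞ (lam i) (x i)
  lam_ne : ∀ x ∈ U, ∀ i j, i ≠ j → lam i (x i) ≠ lam j (x j)
  smooth : ContDiffOn ℝ ∞ f U
  pd_ne : ∀ x ∈ U, ∀ i, pd i f x ≠ 0



theorem smoothOn_lam {U : Set Space} {lam : Fin 3 → ℝ → ℝ} {f : Space → ℝ}
    (W : IsWeb U lam f) (i : Fin 3) : ContDiffOn ℝ ∞ (fun y : Space => lam i (y i)) U :=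
  fun x hx => ((W.smooth_lam x hx i).comp x (contDiff_apply ℝ ℝ i).contDiffAt).contDiffWithinAt

theorem contDiffAt_deriv {g : ℝ → ℝ} {t : ℝ} (h : ContDiffAt ℝ ∞ g t) :
    ContDiffAt ℝ ∞ (deriv g) t := by
  have : ContDiffAt ℝ ∞ (fderiv ℝ g) t := h.fderiv_right (by simp)
  exact this.clm_apply contDiffAt_const

namespace HasScaledPd

variable {f : Space → ℝ} {n : Fin 3} {F G : Space → ℝ} {a b : ℝ} {x : Space}

theorem const_mul (c : ℝ) (hF : HasScaledPd f n F a x) :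
    HasScaledPd f n (fun y => c * F y) (c * a) x :=
  ((const c).mul hF).congr_deriv (by ring)

theorem div_const (hF : HasScaledPd f n F a x) (c : ℝ) :
    HasScaledPd f n (fun y => F y / c) (a / c) x := by
  simp only [div_eq_inv_mul]
  exact hF.const_mul _

end HasScaledPd

/-- The scaled derivative of `gap`. -/
def dGap (lam : Fin 3 → ℝ → ℝ) (f : Space → ℝ) (n i j : Fin 3) (x : Space) : ℝ :=
  (if n = i then slope lam f i x else 0) - if n = j then slope lam f j x else 0

/-- The scaled derivative of `slope`. -/
def dSlope (lam : Fin 3 → ℝ → ℝ) (f : Space → ℝ) (n i : Fin 3) (x : Space) : ℝ :=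
  (if n = i then slope₂ lam f i x else 0) - slope lam f i x * hess f n i x

/-- The scaled derivative of `hess`. -/
def dHess (f : Space → ℝ) (n i j : Fin 3) (x : Space) : ℝ :=
  hess₃ f n i j x - hess f i j x * (hess f n i x + hess f n j x)

/-- The scaled derivative of `hirota`. -/
def dHirota (lam : Fin 3 → ℝ → ℝ) (f : Space → ℝ) (n i j k : Fin 3) (x : Space) : ℝ :=
  dGap lam f n j k x * hess f j k x + gap lam j k x * dHess f n j k x
    + (dGap lam f n k i x * hess f k i x + gap lam k i x * dHess f n k i x)
    + (dGap lam f n i j x * hess f i j x + gap lam i j x * dHess f n i j x)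

namespace IsWeb

variable {U : Set Space} {lam : Fin 3 → ℝ → ℝ} {f : Space → ℝ}

theorem smooth_pd (W : IsWeb U lam f) (i : Fin 3) : ContDiffOn ℝ ∞ (pd i f) U :=
  contDiffOn_pd W.isOpen W.smooth i

theorem smooth_pd_pd (W : IsWeb U lam f) (i j : Fin 3) : ContDiffOn ℝ ∞ (pd i (pd j f)) U :=
  contDiffOn_pd W.isOpen (W.smooth_pd j) i

theorem smooth_gap (W : IsWeb U lam f) (i j : Fin 3) : ContDiffOn ℝ ∞ (gap lam i j) U :=
  (smoothOn_lam W i).sub (smoothOn_lam W j)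

theorem smooth_deriv (W : IsWeb U lam f) (i : Fin 3) :
    ContDiffOn ℝ ∞ (fun y : Space => deriv (lam i) (y i)) U :=
  fun x hx => ((contDiffAt_deriv (W.smooth_lam x hx i)).comp x
    (contDiff_apply ℝ ℝ i).contDiffAt).contDiffWithinAt

theorem smooth_slope (W : IsWeb U lam f) (i : Fin 3) : ContDiffOn ℝ ∞ (slope lam f i) U :=
  (W.smooth_deriv i).div (W.smooth_pd i) fun x hx => W.pd_ne x hx i

theorem smooth_hess (W : IsWeb U lam f) (i j : Fin 3) : ContDiffOn ℝ ∞ (hess f i j) U :=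
  (W.smooth_pd_pd _ _).div ((W.smooth_pd i).mul (W.smooth_pd j)) fun x hx =>
    mul_ne_zero (W.pd_ne x hx i) (W.pd_ne x hx j)

theorem smooth_hirota (W : IsWeb U lam f) (i j k : Fin 3) :
    ContDiffOn ℝ ∞ (hirota lam f i j k) U :=
  (((W.smooth_gap j k).mul (W.smooth_hess j k)).add ((W.smooth_gap k i).mul
    (W.smooth_hess k i))).add ((W.smooth_gap i j).mul (W.smooth_hess i j))

theorem gap_ne (W : IsWeb U lam f) {x : Space} (hx : x ∈ U) {i j : Fin 3} (h : i ≠ j) :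
    gap lam i j x ≠ 0 := sub_ne_zero.2 (W.lam_ne x hx i j h)

theorem pd_min_max (W : IsWeb U lam f) {x : Space} (hx : x ∈ U) (i j : Fin 3) :
    pd (min i j) (pd (max i j) f) x = pd i (pd j f) x := by
  rcases le_total i j with h | h
  · rw [min_eq_left h, max_eq_right h]
  · rw [min_eq_right h, max_eq_left h, pd_comm W.isOpen W.smooth hx]

/-- This is what makes the system closed: the logarithmic derivative of ∂ⱼf along eᵢ is `hess f i
j`, so first partials of `f` enter only as overall weights. -/
theorem pd_pd (W : IsWeb U lam f) {x : Space} (hx : x ∈ U) (i j : Fin 3) :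
    pd i (pd j f) x = pd i f x * pd j f x * hess f i j x := by
  have hi := W.pd_ne x hx i
  have hj := W.pd_ne x hx j
  rw [hess, W.pd_min_max hx]
  field_simp

theorem hess₃_comm_left (W : IsWeb U lam f) {x : Space} (hx : x ∈ U) (n i j : Fin 3) :
    hess₃ f n i j x = hess₃ f i n j x := by
  rw [hess₃, hess₃, pd_congr W.isOpen (fun y hy => W.pd_min_max hy i j) hx,
    pd_congr W.isOpen (fun y hy => W.pd_min_max hy n j) hx,
    pd_comm W.isOpen (W.smooth_pd j) hx n i, mul_comm (pd n f x)]

theorem hasScaledPd_of_contDiffOn {x : Space} {n : Fin 3} {F : Space → ℝ}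
    (W : IsWeb U lam f) (hx : x ∈ U) (hF : ContDiffOn ℝ ∞ F U) {d : ℝ}
    (hd : pd n F x = pd n f x * d) : HasScaledPd f n F d x :=
  ⟨(hF.contDiffAt (W.isOpen.mem_nhds hx)).differentiableAt (by simp), hd⟩

theorem hasScaledPd_pd (W : IsWeb U lam f) {x : Space} (hx : x ∈ U) (n i : Fin 3) :
    HasScaledPd f n (pd i f) (pd i f x * hess f n i x) x :=
  W.hasScaledPd_of_contDiffOn hx (W.smooth_pd i) (by rw [W.pd_pd hx]; ring)

theorem hasScaledPd_comp_coord (W : IsWeb U lam f) {x : Space} (hx : x ∈ U) (n i : Fin 3)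
    {g : ℝ → ℝ} (hg : ContDiffAt ℝ ∞ g (x i)) :
    HasScaledPd f n (fun y => g (y i)) (if n = i then deriv g (x i) / pd i f x else 0) x := by
  have h1 : HasFDerivAt (fun y : Space => g (y i))
      (deriv g (x i) • ContinuousLinearMap.proj (R := ℝ) (φ := fun _ : Fin 3 => ℝ) i) x :=
    (hg.differentiableAt (by simp)).hasDerivAt.comp_hasFDerivAt x (hasFDerivAt_apply i x)
  refine ⟨h1.differentiableAt, ?_⟩
  have hi := W.pd_ne x hx i
  rw [pd, h1.fderiv]
  by_cases h : n = i
  · subst h; simp; field_simp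
  · simp [h, Ne.symm h]

theorem hasScaledPd_gap (W : IsWeb U lam f) {x : Space} (hx : x ∈ U) (n i j : Fin 3) :
    HasScaledPd f n (gap lam i j) (dGap lam f n i j x) x :=
  (W.hasScaledPd_comp_coord hx n i (W.smooth_lam x hx i)).sub
    (W.hasScaledPd_comp_coord hx n j (W.smooth_lam x hx j))

theorem hasScaledPd_slope (W : IsWeb U lam f) {x : Space} (hx : x ∈ U) (n i : Fin 3) :
    HasScaledPd f n (slope lam f i) (dSlope lam f n i x) x := by
  have hi := W.pd_ne x hx i
  refine ((W.hasScaledPd_comp_coord hx n i (contDiffAt_deriv (W.smooth_lam x hx i))).div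
    (W.hasScaledPd_pd hx n i) hi).congr_deriv ?_
  rw [dSlope, slope, slope₂]
  split_ifs
  · field_simp
  · field_simp
    ring

theorem hasScaledPd_hess (W : IsWeb U lam f) {x : Space} (hx : x ∈ U) (n i j : Fin 3) :
    HasScaledPd f n (hess f i j) (dHess f n i j x) x := by
  have hi := W.pd_ne x hx i
  have hj := W.pd_ne x hx j
  have hn := W.pd_ne x hx n
  have h2 : HasScaledPd f n (pd (min i j) (pd (max i j) f))
      (hess₃ f n i j x * pd i f x * pd j f x) x :=
    W.hasScaledPd_of_contDiffOn hx (W.smooth_pd_pd _ _) (by rw [hess₃]; field_simp)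
  refine (h2.div ((W.hasScaledPd_pd hx n i).mul (W.hasScaledPd_pd hx n j))
    (mul_ne_zero hi hj)).congr_deriv ?_
  rw [dHess, W.pd_min_max hx, W.pd_pd hx]
  field_simp

theorem hasScaledPd_hirota (W : IsWeb U lam f) {x : Space} (hx : x ∈ U) (n i j k : Fin 3) :
    HasScaledPd f n (hirota lam f i j k) (dHirota lam f n i j k x) x :=
  (((W.hasScaledPd_gap hx n j k).mul (W.hasScaledPd_hess hx n j k)).add
    ((W.hasScaledPd_gap hx n k i).mul (W.hasScaledPd_hess hx n k i))).add
    ((W.hasScaledPd_gap hx n i j).mul (W.hasScaledPd_hess hx n i j))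

end IsWeb

/-! ### The Christoffel symbols. -/

/-- The Christoffel symbols with three distinct indices, scaled. -/
def gammaDistinct (lam : Fin 3 → ℝ → ℝ) (f : Space → ℝ) (i j k : Fin 3) (x : Space) : ℝ :=
  hirota lam f i j k x / (4 * gap lam i j x)

/-- The Christoffel symbols `Γᵏᵢᵢ`, scaled. -/
def gammaLower (lam : Fin 3 → ℝ → ℝ) (f : Space → ℝ) (i j k : Fin 3) (x : Space) : ℝ :=
  -(gap lam j k x * hirota lam f i j k x / (4 * (gap lam i j x * gap lam k i x)))

/-- The Christoffel symbols `Γⁱᵢⱼ`, scaled. -/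
def gammaMixed (lam : Fin 3 → ℝ → ℝ) (f : Space → ℝ) (i j k : Fin 3) (x : Space) : ℝ :=
  hirota lam f i j k x / (4 * gap lam j k x) + (hess f i j x - hess f j k x) / 4
    - (3 * slope lam f i x + slope lam f j x) / (4 * gap lam i j x)
    + (slope lam f k x - slope lam f j x) / (4 * gap lam j k x)

/-- The Christoffel symbols `Γⁱᵢᵢ`, scaled. -/
def gammaDiag (lam : Fin 3 → ℝ → ℝ) (f : Space → ℝ) (i j k : Fin 3) (x : Space) : ℝ :=
  hess f i i x - (hess f i j x + hess f i k x) / 2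
    + gap lam j k x * hirota lam f i j k x / (4 * (gap lam i j x * gap lam k i x))
    + (slope lam f i x - slope lam f k x) / (2 * gap lam k i x)
    + (slope lam f j x - slope lam f i x) / (2 * gap lam i j x)

/-- The scaled Christoffel symbols of the Weyl connection, in the frame `(1 / ∂ᵢ f) ∂ᵢ`. -/
def gamma (lam : Fin 3 → ℝ → ℝ) (f : Space → ℝ) (k i j : Fin 3) : Space → ℝ :=
  if i = j then
    if k = i then gammaDiag lam f i (i + 1) (i + 2) else gammaLower lam f i (-(i + k)) k
  else if k = i then gammaMixed lam f i j (-(i + j))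
  else if k = j then gammaMixed lam f j i (-(i + j))
  else gammaDistinct lam f i j k

/-- Since 0 + 1 + 2 = 0 in `Fin 3`, the remaining index has a closed formula, which `gamma` uses. -/
theorem neg_add_eq_third : ∀ {i j k : Fin 3}, i ≠ j → i ≠ k → j ≠ k → -(i + j) = k := by decide

section gamma

variable (lam : Fin 3 → ℝ → ℝ) (f : Space → ℝ) {i j k : Fin 3}

theorem gamma_distinct (hij : i ≠ j) (hik : i ≠ k) (hjk : j ≠ k) :
    gamma lam f k i j = gammaDistinct lam f i j k := by
  simp [gamma, hij, hik.symm, hjk.symm]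

theorem gamma_lower (hij : i ≠ j) (hik : i ≠ k) (hjk : j ≠ k) :
    gamma lam f k i i = gammaLower lam f i j k := by
  simp [gamma, hik.symm, ← neg_add_eq_third hik hij hjk.symm]

theorem gamma_mixed (hij : i ≠ j) (hik : i ≠ k) (hjk : j ≠ k) :
    gamma lam f i i j = gammaMixed lam f i j k := by
  simp [gamma, hij, ← neg_add_eq_third hij hik hjk]

theorem gamma_comm (k i j : Fin 3) : gamma lam f k i j = gamma lam f k j i := by
  by_cases hij : i = j
  · rw [hij]
  by_cases hi : k = i
  · simp [gamma, hij, Ne.symm hij, hi, add_comm]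
  by_cases hj : k = j
  · simp [gamma, hij, Ne.symm hij, hj, add_comm]
  rw [gamma_distinct lam f hij (Ne.symm hi) (Ne.symm hj),
    gamma_distinct lam f (Ne.symm hij) (Ne.symm hj) (Ne.symm hi)]
  ext x
  rw [gammaDistinct, gammaDistinct, hirota_swap, gap_swap]
  ring

theorem gamma_mixed' (hij : i ≠ j) (hik : i ≠ k) (hjk : j ≠ k) :
    gamma lam f i j i = gammaMixed lam f i j k := by
  rw [gamma_comm, gamma_mixed lam f hij hik hjk]

/-- Removes the dependence on the cyclic order `i, i + 1, i + 2` chosen in `gamma`. -/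
theorem gammaDiag_swap (i j k : Fin 3) : gammaDiag lam f i j k = gammaDiag lam f i k j := by
  ext x
  rw [gammaDiag, gammaDiag, gap_swap lam k j, gap_swap lam i k, gap_swap lam j i,
    hirota_rotate lam f i k j, hirota_swap lam f k j i, hirota_rotate lam f j k i,
    hirota_rotate lam f k i j]
  ring

theorem gamma_diag : ∀ {i j k : Fin 3}, i ≠ j → i ≠ k → j ≠ k →
    gamma lam f i i i = gammaDiag lam f i j k := by
  have h : ∀ i j k : Fin 3, i ≠ j → i ≠ k → j ≠ k →
      (j = i + 1 ∧ k = i + 2) ∨ (k = i + 1 ∧ j = i + 2) := by decide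
  intro i j k hij hik hjk
  rcases h i j k hij hik hjk with ⟨rfl, rfl⟩ | ⟨rfl, rfl⟩
  · simp [gamma]
  · rw [gammaDiag_swap]; simp [gamma]

end gamma

/-- Allows tensor identities to be proved once for symbolic distinct indices instead of once per
permutation. -/
theorem sum_distinct {i j k : Fin 3} (hij : i ≠ j) (hik : i ≠ k) (hjk : j ≠ k) (F : Fin 3 → ℝ) :
    ∑ m, F m = F i + F j + F k := by
  have : (Finset.univ : Finset (Fin 3)) = {i, j, k} := by
    revert i j k; decide
  rw [this, Finset.sum_insert (by simp [hij, hik]), Finset.sum_pair hjk, add_assoc]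

/-- The Christoffel symbols of the Weyl connection. -/
def webConnection (lam : Fin 3 → ℝ → ℝ) (f : Space → ℝ) : Christoffel := fun x k i j =>
  pd i f x * pd j f x / pd k f x * gamma lam f k i j x

/-! ### Components of the metric and of the 1-form for symbolic indices. -/

section explicit

variable (lam : Fin 3 → ℝ → ℝ) (f : Space → ℝ)

theorem webMetric_diag : ∀ {i j k : Fin 3}, i ≠ j → i ≠ k → j ≠ k → ∀ x : Space,
    webMetric lam f x i i = gap lam j k x ^ 2 * pd i f x / (pd j f x * pd k f x) := by
  intro i j k hij hik hjk x
  fin_cases i <;> fin_cases j <;> fin_cases k <;> simp at hij hik hjk <;>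
    simp [webMetric, gap] <;> ring

theorem webMetric_offDiag : ∀ {i j k : Fin 3}, i ≠ j → i ≠ k → j ≠ k → ∀ x : Space,
    webMetric lam f x i j = -(gap lam k i x * gap lam j k x / pd k f x) := by
  intro i j k hij hik hjk x
  fin_cases i <;> fin_cases j <;> fin_cases k <;> simp at hij hik hjk <;>
    simp [webMetric, gap] <;> ring

theorem webForm_eq {i j k : Fin 3} (hij : i ≠ j) (hik : i ≠ k) (hjk : j ≠ k) (x : Space) :
    webForm lam f x i = (1 / gap lam i j x + 1 / gap lam i k x) * deriv (lam i) (x i)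
      - 1 / gap lam i j x * (pd i f x / pd j f x) * deriv (lam j) (x j)
      - 1 / gap lam i k x * (pd i f x / pd k f x) * deriv (lam k) (x k)
      - pd i (pd i f) x / pd i f x := by
  fin_cases i <;> fin_cases j <;> fin_cases k <;> simp at hij hik hjk <;>
    simp [webForm, gap] <;> ring

end explicit

/-! ### Uniqueness of the Weyl connection. -/

theorem IsMetricOn.symm_apply {U : Set Space} {g : Space → Matrix (Fin 3) (Fin 3) ℝ}
    (hg : IsMetricOn U g) {x : Space} (hx : x ∈ U) (i j : Fin 3) : g x i j = g x j i :=
  (hg.symm x hx).apply j i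

/-- A metric and a one-form determine the Weyl connection. -/
theorem IsWeylConnection.unique {U : Set Space} {g : Space → Matrix (Fin 3) (Fin 3) ℝ}
    {w : Space → Fin 3 → ℝ} {Γ Γ' : Christoffel} (hg : IsMetricOn U g)
    (h : IsWeylConnection U g w Γ) (h' : IsWeylConnection U g w Γ') {x : Space} (hx : x ∈ U) :
    Γ' x = Γ x := by
  set T : Fin 3 → Fin 3 → Fin 3 → ℝ := fun l k i => Γ' x l k i - Γ x l k i with hT
  set S : Fin 3 → Fin 3 → Fin 3 → ℝ := fun k i j => ∑ l, T l k i * g x l j with hS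
  have hsymm : ∀ k i j, S k i j = S i k j := by
    intro k i j
    simp only [hS, hT, h.torsionFree x hx _ k i, h'.torsionFree x hx _ k i]
  have hskew : ∀ k i j, S k i j + S k j i = 0 := by
    intro k i j
    have h1 := h.compatible x hx k i j
    have h2 := h'.compatible x hx k i j
    simp only [covDerivMetric, hg.symm_apply hx i _] at h1 h2
    simp only [hS, hT, sub_mul, Finset.sum_sub_distrib]
    linarith
  -- A 3-tensor symmetric in its first two indices and skew in its last two vanishes.
  have hzero : ∀ k i j, S k i j = 0 := by
    intro k i j
    linarith [hskew k i j, hskew i j k, hskew j k i, hsymm k i j, hsymm i j k, hsymm j k i]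
  funext l k i
  have hv : Matrix.vecMul (fun l => T l k i) (g x) = 0 := by
    ext j; exact hzero k i j
  have := Matrix.eq_zero_of_vecMul_eq_zero (hg.nondeg x hx) hv
  have := congrFun this l
  simp only [hT, Pi.zero_apply] at this
  linarith

theorem exists_distinct : ∀ i : Fin 3, ∃ j k : Fin 3, i ≠ j ∧ i ≠ k ∧ j ≠ k := by decide

theorem exists_third : ∀ i j : Fin 3, i ≠ j → ∃ k : Fin 3, i ≠ k ∧ j ≠ k := by decide

/-! ### Nondegeneracy and smoothness. -/

namespace IsWeb

variable {U : Set Space} {lam : Fin 3 → ℝ → ℝ} {f : Space → ℝ}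

theorem isMetricOn (W : IsWeb U lam f) : IsMetricOn U (webMetric lam f) where
  smooth i j := by
    by_cases hij : i = j
    · subst hij
      obtain ⟨j, k, hij, hik, hjk⟩ := exists_distinct i
      simp only [webMetric_diag lam f hij hik hjk]
      exact (((W.smooth_gap j k).pow 2).mul (W.smooth_pd i)).div
        ((W.smooth_pd j).mul (W.smooth_pd k)) fun x hx =>
          mul_ne_zero (W.pd_ne x hx j) (W.pd_ne x hx k)
    · obtain ⟨k, hik, hjk⟩ := exists_third i j hij
      simp only [webMetric_offDiag lam f hij hik hjk]
      exact (((W.smooth_gap k i).mul (W.smooth_gap j k)).div (W.smooth_pd k)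
        fun x hx => W.pd_ne x hx k).neg
  symm x hx := by
    ext i j
    rw [Matrix.transpose_apply]
    by_cases hij : i = j
    · rw [hij]
    · obtain ⟨k, hik, hjk⟩ := exists_third i j hij
      rw [webMetric_offDiag lam f hij hik hjk, webMetric_offDiag lam f (Ne.symm hij) hjk hik,
        gap_swap lam k j, gap_swap lam i k]
      ring
  nondeg x hx := by
    have h0 := W.pd_ne x hx 0
    have h1 := W.pd_ne x hx 1
    have h2 := W.pd_ne x hx 2
    -- Once rows and columns are scaled by fᵢ and αᵢ, what remains is the matrix with 1 on the
    -- diagonal and −1 elsewhere, of determinant −4.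
    have : (webMetric lam f x).det
        = -4 * (gap lam 0 1 x * gap lam 1 2 x * gap lam 2 0 x) ^ 2
          / (pd 0 f x * pd 1 f x * pd 2 f x) := by
      rw [Matrix.det_fin_three]
      simp [webMetric, gap]
      field_simp
      ring
    rw [this]
    have g1 := W.gap_ne hx (show (0 : Fin 3) ≠ 1 by decide)
    have g2 := W.gap_ne hx (show (1 : Fin 3) ≠ 2 by decide)
    have g3 := W.gap_ne hx (show (2 : Fin 3) ≠ 0 by decide)
    simp [h0, h1, h2, g1, g2, g3]

theorem isOneFormOn (W : IsWeb U lam f) : IsOneFormOn U (webForm lam f) := by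
  intro i
  obtain ⟨j, k, hij, hik, hjk⟩ := exists_distinct i
  simp only [webForm_eq lam f hij hik hjk]
  have d1 : ∀ m, i ≠ m → ContDiffOn ℝ ∞ (fun x => 1 / gap lam i m x) U := fun m hm =>
    contDiffOn_const.div (W.smooth_gap i m) fun x hx => W.gap_ne hx hm
  have d2 : ∀ m, ContDiffOn ℝ ∞ (fun x => pd i f x / pd m f x) U := fun m =>
    (W.smooth_pd i).div (W.smooth_pd m) fun x hx => W.pd_ne x hx m
  exact (((((d1 j hij).add (d1 k hik)).mul (W.smooth_deriv i)).sub
    (((d1 j hij).mul (d2 j)).mul (W.smooth_deriv j))).sub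
    (((d1 k hik).mul (d2 k)).mul (W.smooth_deriv k))).sub
    ((W.smooth_pd_pd i i).div (W.smooth_pd i) fun x hx => W.pd_ne x hx i)

theorem smooth_gammaDistinct (W : IsWeb U lam f) {i j : Fin 3} (k : Fin 3) (hij : i ≠ j) :
    ContDiffOn ℝ ∞ (gammaDistinct lam f i j k) U :=
  (W.smooth_hirota i j k).div (contDiffOn_const.mul (W.smooth_gap i j)) fun _ hx =>
    mul_ne_zero four_ne_zero (W.gap_ne hx hij)

theorem smooth_gap_mul_hirota_div (W : IsWeb U lam f) {i j k : Fin 3} (hij : i ≠ j)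
    (hik : i ≠ k) : ContDiffOn ℝ ∞
      (fun x => gap lam j k x * hirota lam f i j k x / (4 * (gap lam i j x * gap lam k i x))) U :=
  ((W.smooth_gap j k).mul (W.smooth_hirota i j k)).div
    (contDiffOn_const.mul ((W.smooth_gap i j).mul (W.smooth_gap k i))) fun _ hx =>
      mul_ne_zero four_ne_zero (mul_ne_zero (W.gap_ne hx hij) (W.gap_ne hx (Ne.symm hik)))

theorem smooth_gammaMixed (W : IsWeb U lam f) {i j k : Fin 3} (hij : i ≠ j) (hjk : j ≠ k) :
    ContDiffOn ℝ ∞ (gammaMixed lam f i j k) U := by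
  have hd : ContDiffOn ℝ ∞ (fun x => 4 * gap lam j k x) U :=
    contDiffOn_const.mul (W.smooth_gap j k)
  have hd' : ∀ x ∈ U, 4 * gap lam j k x ≠ 0 := fun _ hx =>
    mul_ne_zero four_ne_zero (W.gap_ne hx hjk)
  exact ((((W.smooth_hirota i j k).div hd hd').add
    (((W.smooth_hess i j).sub (W.smooth_hess j k)).div_const 4)).sub
    (((contDiffOn_const.mul (W.smooth_slope i)).add (W.smooth_slope j)).div
      (contDiffOn_const.mul (W.smooth_gap i j)) fun _ hx =>
        mul_ne_zero four_ne_zero (W.gap_ne hx hij))).add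
    (((W.smooth_slope k).sub (W.smooth_slope j)).div hd hd')

theorem smooth_gammaDiag (W : IsWeb U lam f) {i j k : Fin 3} (hij : i ≠ j) (hik : i ≠ k) :
    ContDiffOn ℝ ∞ (gammaDiag lam f i j k) U :=
  ((((W.smooth_hess i i).sub (((W.smooth_hess i j).add (W.smooth_hess i k)).div_const 2)).add
    (W.smooth_gap_mul_hirota_div hij hik)).add
    (((W.smooth_slope i).sub (W.smooth_slope k)).div
      (contDiffOn_const.mul (W.smooth_gap k i)) fun _ hx =>
        mul_ne_zero two_ne_zero (W.gap_ne hx (Ne.symm hik)))).add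
    (((W.smooth_slope j).sub (W.smooth_slope i)).div
      (contDiffOn_const.mul (W.smooth_gap i j)) fun _ hx =>
        mul_ne_zero two_ne_zero (W.gap_ne hx hij))

theorem smooth_gamma (W : IsWeb U lam f) (k i j : Fin 3) :
    ContDiffOn ℝ ∞ (gamma lam f k i j) U := by
  by_cases hij : i = j
  · subst hij
    by_cases hk : i = k
    · subst hk
      obtain ⟨j, k, hij, hik, hjk⟩ := exists_distinct i
      rw [gamma_diag lam f hij hik hjk]
      exact W.smooth_gammaDiag hij hik
    · obtain ⟨j, hij, hkj⟩ := exists_third i k hk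
      rw [gamma_lower lam f hij hk (Ne.symm hkj)]
      exact (W.smooth_gap_mul_hirota_div hij hk).neg
  · by_cases hi : i = k
    · subst hi
      obtain ⟨k, hik, hjk⟩ := exists_third i j hij
      rw [gamma_mixed lam f hij hik hjk]
      exact W.smooth_gammaMixed hij hjk
    · by_cases hj : j = k
      · subst hj
        obtain ⟨k, hik, hjk⟩ := exists_third i j hij
        rw [gamma_mixed' lam f (Ne.symm hij) hjk hik]
        exact W.smooth_gammaMixed (Ne.symm hij) hik
      · rw [gamma_distinct lam f hij hi hj]
        exact W.smooth_gammaDistinct k hij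

theorem webForm_eq_slope (W : IsWeb U lam f) {x : Space} (hx : x ∈ U) {i j k : Fin 3}
    (hij : i ≠ j) (hik : i ≠ k) (hjk : j ≠ k) :
    webForm lam f x i = pd i f x * ((slope lam f i x - slope lam f j x) / gap lam i j x
      + (slope lam f k x - slope lam f i x) / gap lam k i x - hess f i i x) := by
  have hi := W.pd_ne x hx i
  have hj := W.pd_ne x hx j
  have hk := W.pd_ne x hx k
  have g1 := W.gap_ne hx hij
  have g2 := W.gap_ne hx (Ne.symm hik)
  rw [webForm_eq lam f hij hik hjk, W.pd_pd hx, gap_swap lam i k, slope, slope, slope]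
  field_simp
  ring

theorem pd_webMetric_diag (W : IsWeb U lam f) {x : Space} (hx : x ∈ U) (n : Fin 3) {i j k : Fin 3}
    (hij : i ≠ j) (hik : i ≠ k) (hjk : j ≠ k) :
    pd n (fun y => webMetric lam f y i i) x = pd n f x * pd i f x / (pd j f x * pd k f x) *
      (2 * gap lam j k x * dGap lam f n j k x
        + gap lam j k x ^ 2 * (hess f n i x - hess f n j x - hess f n k x)) := by
  have hj := W.pd_ne x hx j
  have hk := W.pd_ne x hx k
  simp only [webMetric_diag lam f hij hik hjk, pow_two]
  rw [((((W.hasScaledPd_gap hx n j k).mul (W.hasScaledPd_gap hx n j k)).mul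
    (W.hasScaledPd_pd hx n i)).div ((W.hasScaledPd_pd hx n j).mul (W.hasScaledPd_pd hx n k))
    (mul_ne_zero hj hk)).2]
  field_simp
  ring

theorem pd_webMetric_offDiag (W : IsWeb U lam f) {x : Space} (hx : x ∈ U) (n : Fin 3)
    {i j k : Fin 3} (hij : i ≠ j) (hik : i ≠ k) (hjk : j ≠ k) :
    pd n (fun y => webMetric lam f y i j) x = -(pd n f x / pd k f x *
      (dGap lam f n k i x * gap lam j k x + gap lam k i x * dGap lam f n j k x
        - gap lam k i x * gap lam j k x * hess f n k x)) := by
  have hk := W.pd_ne x hx k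
  simp only [webMetric_offDiag lam f hij hik hjk]
  rw [(((W.hasScaledPd_gap hx n k i).mul (W.hasScaledPd_gap hx n j k)).div
    (W.hasScaledPd_pd hx n k) hk).neg.2]
  field_simp

end IsWeb

/-! ### Compatibility of the connection with the metric. -/

/-- The linear relation between the three differences; after clearing denominators, eliminating one
of them turns the remaining claims into polynomial identities. -/
theorem gap_add (lam : Fin 3 → ℝ → ℝ) (i j k : Fin 3) (x : Space) :
    gap lam k i x = -gap lam i j x - gap lam j k x := by
  simp only [gap]; ring

theorem hirota_swap_right (lam : Fin 3 → ℝ → ℝ) (f : Space → ℝ) (i j k : Fin 3) (x : Space) :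
    hirota lam f i k j x = -hirota lam f i j k x := by
  rw [← hirota_rotate, hirota_swap, hirota_rotate]

theorem hirota_cycle (lam : Fin 3 → ℝ → ℝ) (f : Space → ℝ) (i j k : Fin 3) (x : Space) :
    hirota lam f j k i x = hirota lam f i j k x ∧ hirota lam f k i j x = hirota lam f i j k x :=
  ⟨(hirota_rotate lam f i j k x).symm, hirota_rotate lam f k i j x⟩

/-- The scaled Christoffel symbols with a given upper index `i`. -/
theorem gamma_table (lam : Fin 3 → ℝ → ℝ) (f : Space → ℝ) {i j k : Fin 3}
    (hij : i ≠ j) (hik : i ≠ k) (hjk : j ≠ k) (x : Space) :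
    gamma lam f i i i x = hess f i i x - (hess f i j x + hess f k i x) / 2
        + gap lam j k x * hirota lam f i j k x / (4 * (gap lam i j x * gap lam k i x))
        + (slope lam f i x - slope lam f k x) / (2 * gap lam k i x)
        + (slope lam f j x - slope lam f i x) / (2 * gap lam i j x) ∧
    gamma lam f i j k x = hirota lam f i j k x / (4 * gap lam j k x) ∧
    gamma lam f i k j x = hirota lam f i j k x / (4 * gap lam j k x) ∧
    gamma lam f i j j x
      = -(gap lam k i x * hirota lam f i j k x / (4 * (gap lam i j x * gap lam j k x))) ∧
    gamma lam f i k k x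
      = -(gap lam i j x * hirota lam f i j k x / (4 * (gap lam k i x * gap lam j k x))) ∧
    gamma lam f i i j x
      = hirota lam f i j k x / (4 * gap lam j k x) + (hess f i j x - hess f j k x) / 4
        - (3 * slope lam f i x + slope lam f j x) / (4 * gap lam i j x)
        + (slope lam f k x - slope lam f j x) / (4 * gap lam j k x) ∧
    gamma lam f i j i x
      = hirota lam f i j k x / (4 * gap lam j k x) + (hess f i j x - hess f j k x) / 4
        - (3 * slope lam f i x + slope lam f j x) / (4 * gap lam i j x)
        + (slope lam f k x - slope lam f j x) / (4 * gap lam j k x) ∧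
    gamma lam f i i k x
      = hirota lam f i j k x / (4 * gap lam j k x) + (hess f k i x - hess f j k x) / 4
        + (3 * slope lam f i x + slope lam f k x) / (4 * gap lam k i x)
        + (slope lam f k x - slope lam f j x) / (4 * gap lam j k x) ∧
    gamma lam f i k i x
      = hirota lam f i j k x / (4 * gap lam j k x) + (hess f k i x - hess f j k x) / 4
        + (3 * slope lam f i x + slope lam f k x) / (4 * gap lam k i x)
        + (slope lam f k x - slope lam f j x) / (4 * gap lam j k x) := by
  rw [gamma_diag lam f hij hik hjk, gamma_distinct lam f hjk hij.symm hik.symm,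
    gamma_distinct lam f hjk.symm hik.symm hij.symm, gamma_lower lam f hjk hij.symm hik.symm,
    gamma_lower lam f hjk.symm hik.symm hij.symm, gamma_mixed lam f hij hik hjk,
    gamma_mixed lam f hik hij hjk.symm, gamma_mixed' lam f hij hik hjk,
    gamma_mixed' lam f hik hij hjk.symm]
  simp only [gammaDiag, gammaDistinct, gammaLower, gammaMixed, hirota_cycle lam f i j k,
    hirota_swap_right lam f i j k, hirota_swap_right lam f k i j,
    gap_swap lam k j, gap_swap lam j i, gap_swap lam i k,
    hess_comm f k j, hess_comm f i k]
  refine ⟨?_, ?_, ?_, ?_, ?_, ?_, ?_, ?_, ?_⟩ <;> first | trivial | ring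

theorem webMetric_table (lam : Fin 3 → ℝ → ℝ) (f : Space → ℝ) {i j k : Fin 3}
    (hij : i ≠ j) (hik : i ≠ k) (hjk : j ≠ k) (x : Space) :
    webMetric lam f x i i = gap lam j k x ^ 2 * pd i f x / (pd j f x * pd k f x) ∧
    webMetric lam f x i j = -(gap lam k i x * gap lam j k x / pd k f x) ∧
    webMetric lam f x i k = -(gap lam i j x * gap lam j k x / pd j f x) := by
  rw [webMetric_diag lam f hij hik hjk, webMetric_offDiag lam f hij hik hjk,
    webMetric_offDiag lam f hik hij hjk.symm, gap_swap lam k j, gap_swap lam j i]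
  refine ⟨rfl, rfl, ?_⟩
  ring

namespace IsWeb

variable {U : Set Space} {lam : Fin 3 → ℝ → ℝ} {f : Space → ℝ}

theorem compatible_diag_self (W : IsWeb U lam f) {x : Space} (hx : x ∈ U) {i j k : Fin 3}
    (hij : i ≠ j) (hik : i ≠ k) (hjk : j ≠ k) :
    covDerivMetric (webConnection lam f) (webMetric lam f) x i i i
      = webForm lam f x i * webMetric lam f x i i := by
  have hi := W.pd_ne x hx i
  have hj := W.pd_ne x hx j
  have hk := W.pd_ne x hx k
  have g1 := W.gap_ne hx hij
  have g2 := W.gap_ne hx hjk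
  have g3 := W.gap_ne hx (Ne.symm hik)
  rw [covDerivMetric, sum_distinct hij hik hjk, sum_distinct hij hik hjk,
    W.pd_webMetric_diag hx i hij hik hjk, W.webForm_eq_slope hx hij hik hjk]
  simp only [webConnection, gamma_table lam f hij hik hjk,
    gamma_table lam f hjk hij.symm hik.symm, gamma_table lam f hik.symm hjk.symm hij,
    webMetric_table lam f hij hik hjk, webMetric_table lam f hjk hij.symm hik.symm,
    webMetric_table lam f hik.symm hjk.symm hij, hirota_cycle lam f i j k,
    hess_comm f i k, dGap, hij, hik, ↓reduceIte]
  field_simp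
  rw [gap_add lam i j k]
  ring

theorem compatible_diag_ne (W : IsWeb U lam f) {x : Space} (hx : x ∈ U) {i j k : Fin 3}
    (hij : i ≠ j) (hik : i ≠ k) (hjk : j ≠ k) :
    covDerivMetric (webConnection lam f) (webMetric lam f) x j i i
      = webForm lam f x j * webMetric lam f x i i := by
  have hi := W.pd_ne x hx i
  have hj := W.pd_ne x hx j
  have hk := W.pd_ne x hx k
  have g1 := W.gap_ne hx hij
  have g2 := W.gap_ne hx hjk
  have g3 := W.gap_ne hx (Ne.symm hik)
  rw [covDerivMetric, sum_distinct hij hik hjk, sum_distinct hij hik hjk,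
    W.pd_webMetric_diag hx j hij hik hjk, W.webForm_eq_slope hx hij.symm hjk hik]
  simp only [webConnection, gamma_table lam f hij hik hjk,
    gamma_table lam f hjk hij.symm hik.symm, gamma_table lam f hik.symm hjk.symm hij,
    webMetric_table lam f hij hik hjk, webMetric_table lam f hjk hij.symm hik.symm,
    webMetric_table lam f hik.symm hjk.symm hij, hirota_cycle lam f i j k,
    gap_swap lam k j, gap_swap lam j i,
    hess_comm f j i, dGap, hjk, ↓reduceIte]
  -- Unlike in `compatible_diag_self`, H is not treated as an independent atom: its expansion must
  -- combine with the separate `hess` terms.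
  simp only [hirota]
  field_simp
  rw [gap_add lam i j k]
  ring

theorem compatible_offDiag_left (W : IsWeb U lam f) {x : Space} (hx : x ∈ U) {i j k : Fin 3}
    (hij : i ≠ j) (hik : i ≠ k) (hjk : j ≠ k) :
    covDerivMetric (webConnection lam f) (webMetric lam f) x i i j
      = webForm lam f x i * webMetric lam f x i j := by
  have hi := W.pd_ne x hx i
  have hj := W.pd_ne x hx j
  have hk := W.pd_ne x hx k
  have g1 := W.gap_ne hx hij
  have g2 := W.gap_ne hx hjk
  have g3 := W.gap_ne hx (Ne.symm hik)
  rw [covDerivMetric, sum_distinct hij hik hjk, sum_distinct hij hik hjk,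
    W.pd_webMetric_offDiag hx i hij hik hjk, W.webForm_eq_slope hx hij hik hjk]
  simp only [webConnection, gamma_table lam f hij hik hjk,
    gamma_table lam f hjk hij.symm hik.symm, gamma_table lam f hik.symm hjk.symm hij,
    webMetric_table lam f hij hik hjk, webMetric_table lam f hjk hij.symm hik.symm,
    webMetric_table lam f hik.symm hjk.symm hij, hirota_cycle lam f i j k,
    hess_comm f i k, dGap, hij, hik, ↓reduceIte]
  simp only [hirota]
  field_simp
  rw [gap_add lam i j k]
  ring

theorem compatible_offDiag_third (W : IsWeb U lam f) {x : Space} (hx : x ∈ U) {i j k : Fin 3}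
    (hij : i ≠ j) (hik : i ≠ k) (hjk : j ≠ k) :
    covDerivMetric (webConnection lam f) (webMetric lam f) x k i j
      = webForm lam f x k * webMetric lam f x i j := by
  have hi := W.pd_ne x hx i
  have hj := W.pd_ne x hx j
  have hk := W.pd_ne x hx k
  have g1 := W.gap_ne hx hij
  have g2 := W.gap_ne hx hjk
  have g3 := W.gap_ne hx (Ne.symm hik)
  rw [covDerivMetric, sum_distinct hij hik hjk, sum_distinct hij hik hjk,
    W.pd_webMetric_offDiag hx k hij hik hjk, W.webForm_eq_slope hx hik.symm hjk.symm hij]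
  simp only [webConnection, gamma_table lam f hij hik hjk,
    gamma_table lam f hjk hij.symm hik.symm, gamma_table lam f hik.symm hjk.symm hij,
    webMetric_table lam f hij hik hjk, webMetric_table lam f hjk hij.symm hik.symm,
    webMetric_table lam f hik.symm hjk.symm hij, hirota_cycle lam f i j k,
    dGap, hik.symm, hjk.symm, ↓reduceIte]
  simp only [hirota]
  field_simp
  rw [gap_add lam i j k]
  ring

/-- By symmetry in the last two indices, the 27 components of the compatibility condition reduce to
the four index patterns above. -/
theorem isWeylConnection (W : IsWeb U lam f) :
    IsWeylConnection U (webMetric lam f) (webForm lam f) (webConnection lam f) where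
  smooth k i j := (((W.smooth_pd i).mul (W.smooth_pd j)).div (W.smooth_pd k)
    fun x hx => W.pd_ne x hx k).mul (W.smooth_gamma k i j)
  torsionFree x _ k i j := by
    rw [webConnection, webConnection, gamma_comm, mul_comm (pd i f x)]
  compatible x hx n i j := by
    have hswap : ∀ n i j : Fin 3, covDerivMetric (webConnection lam f) (webMetric lam f) x n i j
        = covDerivMetric (webConnection lam f) (webMetric lam f) x n j i := by
      intro n i j
      rw [covDerivMetric, covDerivMetric, pd_congr W.isOpen
        (fun y hy => W.isMetricOn.symm_apply hy i j) hx]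
      simp only [W.isMetricOn.symm_apply hx _ i, W.isMetricOn.symm_apply hx _ j]
      ring
    by_cases hij : i = j
    · subst hij
      by_cases hn : i = n
      · subst hn
        obtain ⟨j, k, hij, hik, hjk⟩ := exists_distinct i
        exact W.compatible_diag_self hx hij hik hjk
      · obtain ⟨k, hik, hnk⟩ := exists_third i n hn
        exact W.compatible_diag_ne hx hn hik hnk
    · by_cases hi : i = n
      · subst hi
        obtain ⟨k, hik, hjk⟩ := exists_third i j hij
        exact W.compatible_offDiag_left hx hij hik hjk
      · by_cases hj : j = n
        · subst hj
          obtain ⟨k, hik, hjk⟩ := exists_third i j hij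
          rw [hswap, W.isMetricOn.symm_apply hx i]
          exact W.compatible_offDiag_left hx (Ne.symm hij) hjk hik
        · exact W.compatible_offDiag_third hx hij hi hj

end IsWeb

/-! ### The Ricci tensor in scaled form. -/

/-- The derivative of `F` in the direction of `(1 / ∂ₙ f) ∂ₙ`. -/
def scaledPd (f : Space → ℝ) (n : Fin 3) (F : Space → ℝ) (x : Space) : ℝ := pd n F x / pd n f x

/-- The scaled Ricci tensor of the Weyl connection. -/
def scaledRicci (lam : Fin 3 → ℝ → ℝ) (f : Space → ℝ) (i j : Fin 3) (x : Space) : ℝ :=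
  ∑ k, (scaledPd f k (gamma lam f k i j) x
    + gamma lam f k i j x * (hess f k i x + hess f k j x - hess f k k x)
    - (scaledPd f i (gamma lam f k k j) x + gamma lam f k k j x * hess f i j x)
    + ∑ m, (gamma lam f k k m x * gamma lam f m i j x - gamma lam f k i m x * gamma lam f m k j x))

namespace IsWeb

variable {U : Set Space} {lam : Fin 3 → ℝ → ℝ} {f : Space → ℝ}

theorem scaledPd_eq (W : IsWeb U lam f) {x : Space} (hx : x ∈ U) {n : Fin 3} {F : Space → ℝ}
    {d : ℝ} (h : HasScaledPd f n F d x) : scaledPd f n F x = d := by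
  have := W.pd_ne x hx n
  rw [scaledPd, h.2]
  field_simp

/-- The weight fᵢfⱼ/fₖ has logarithmic derivative hₙᵢ + hₙⱼ − hₙₖ along eₙ, where h is `hess`; this
produces the correction terms in `scaledRicci`. -/
theorem pd_webConnection (W : IsWeb U lam f) {x : Space} (hx : x ∈ U) (n k i j : Fin 3) :
    pd n (fun y => webConnection lam f y k i j) x = pd n f x * (pd i f x * pd j f x / pd k f x) *
      (scaledPd f n (gamma lam f k i j) x
        + gamma lam f k i j x * (hess f n i x + hess f n j x - hess f n k x)) := by
  have hk := W.pd_ne x hx k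
  have hn := W.pd_ne x hx n
  have h : HasScaledPd f n (gamma lam f k i j) (scaledPd f n (gamma lam f k i j) x) x :=
    W.hasScaledPd_of_contDiffOn hx (W.smooth_gamma k i j) (by rw [scaledPd]; field_simp)
  simp only [webConnection]
  rw [((((W.hasScaledPd_pd hx n i).mul (W.hasScaledPd_pd hx n j)).div
    (W.hasScaledPd_pd hx n k) hk).mul h).2]
  field_simp
  ring

theorem ricci_webConnection (W : IsWeb U lam f) {x : Space} (hx : x ∈ U) (i j : Fin 3) :
    ricci (webConnection lam f) x i j = pd i f x * pd j f x * scaledRicci lam f i j x := by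
  rw [ricci, scaledRicci, Finset.mul_sum]
  refine Finset.sum_congr rfl fun k _ => ?_
  have hk := W.pd_ne x hx k
  rw [curvature, W.pd_webConnection hx, W.pd_webConnection hx,
    mul_add (pd i f x * pd j f x) (_ - _), Finset.mul_sum]
  congr 1
  · field_simp
    ring
  · refine Finset.sum_congr rfl fun m _ => ?_
    have hm := W.pd_ne x hx m
    simp only [webConnection]
    field_simp

theorem hasScaledPd_gap_mul_hirota_div (W : IsWeb U lam f) {x : Space} (hx : x ∈ U) (n : Fin 3)
    {i j k : Fin 3} (hij : i ≠ j) (hik : i ≠ k) :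
    HasScaledPd f n
      (fun y => gap lam j k y * hirota lam f i j k y / (4 * (gap lam i j y * gap lam k i y)))
      ((dGap lam f n j k x * hirota lam f i j k x + gap lam j k x * dHirota lam f n i j k x)
          / (4 * (gap lam i j x * gap lam k i x))
        - gap lam j k x * hirota lam f i j k x * (dGap lam f n i j x * gap lam k i x
          + gap lam i j x * dGap lam f n k i x) / (4 * (gap lam i j x * gap lam k i x) ^ 2)) x := by
  have g1 := W.gap_ne hx hij
  have g3 := W.gap_ne hx (Ne.symm hik)
  refine (((W.hasScaledPd_gap hx n j k).mul (W.hasScaledPd_hirota hx n i j k)).div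
    (((W.hasScaledPd_gap hx n i j).mul (W.hasScaledPd_gap hx n k i)).const_mul 4)
    (mul_ne_zero four_ne_zero (mul_ne_zero g1 g3))).congr_deriv ?_
  field_simp

theorem hasScaledPd_div_gap (W : IsWeb U lam f) {x : Space} (hx : x ∈ U) {n : Fin 3}
    {i j : Fin 3} (hij : i ≠ j) {c : ℝ} (hc : c ≠ 0) {F : Space → ℝ} {d : ℝ}
    (hF : HasScaledPd f n F d x) : HasScaledPd f n (fun y => F y / (c * gap lam i j y))
      (d / (c * gap lam i j x) - F x * dGap lam f n i j x / (c * gap lam i j x ^ 2)) x := by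
  have g1 := W.gap_ne hx hij
  refine (hF.div ((W.hasScaledPd_gap hx n i j).const_mul c) (mul_ne_zero hc g1)).congr_deriv ?_
  field_simp

theorem scaledPd_gamma_distinct (W : IsWeb U lam f) {x : Space} (hx : x ∈ U) (n : Fin 3)
    {i j k : Fin 3} (hij : i ≠ j) (hik : i ≠ k) (hjk : j ≠ k) :
    scaledPd f n (gamma lam f i j k) x = dHirota lam f n i j k x / (4 * gap lam j k x)
      - hirota lam f i j k x * dGap lam f n j k x / (4 * gap lam j k x ^ 2) := by
  rw [funext fun y => (gamma_table lam f hij hik hjk y).2.1]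
  exact W.scaledPd_eq hx
    (W.hasScaledPd_div_gap hx hjk four_ne_zero (W.hasScaledPd_hirota hx n i j k))

theorem scaledPd_gamma_lower (W : IsWeb U lam f) {x : Space} (hx : x ∈ U) (n : Fin 3)
    {i j k : Fin 3} (hij : i ≠ j) (hik : i ≠ k) (hjk : j ≠ k) :
    scaledPd f n (gamma lam f k i i) x =
      -((dGap lam f n j k x * hirota lam f i j k x + gap lam j k x * dHirota lam f n i j k x)
          / (4 * (gap lam i j x * gap lam k i x))
        - gap lam j k x * hirota lam f i j k x * (dGap lam f n i j x * gap lam k i x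
          + gap lam i j x * dGap lam f n k i x) / (4 * (gap lam i j x * gap lam k i x) ^ 2)) := by
  rw [gamma_lower lam f hij hik hjk]
  exact W.scaledPd_eq hx (W.hasScaledPd_gap_mul_hirota_div hx n hij hik).neg

theorem scaledPd_gamma_mixed (W : IsWeb U lam f) {x : Space} (hx : x ∈ U) (n : Fin 3)
    {i j k : Fin 3} (hij : i ≠ j) (hik : i ≠ k) (hjk : j ≠ k) :
    scaledPd f n (gamma lam f i i j) x =
      dHirota lam f n i j k x / (4 * gap lam j k x)
        - hirota lam f i j k x * dGap lam f n j k x / (4 * gap lam j k x ^ 2)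
        + (dHess f n i j x - dHess f n j k x) / 4
        - ((3 * dSlope lam f n i x + dSlope lam f n j x) / (4 * gap lam i j x)
          - (3 * slope lam f i x + slope lam f j x) * dGap lam f n i j x
            / (4 * gap lam i j x ^ 2))
        + ((dSlope lam f n k x - dSlope lam f n j x) / (4 * gap lam j k x)
          - (slope lam f k x - slope lam f j x) * dGap lam f n j k x
            / (4 * gap lam j k x ^ 2)) := by
  rw [gamma_mixed lam f hij hik hjk]
  exact W.scaledPd_eq hx
    ((((W.hasScaledPd_div_gap hx hjk four_ne_zero (W.hasScaledPd_hirota hx n i j k)).add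
      (((W.hasScaledPd_hess hx n i j).sub (W.hasScaledPd_hess hx n j k)).div_const 4)).sub
      (W.hasScaledPd_div_gap hx hij four_ne_zero
        (((W.hasScaledPd_slope hx n i).const_mul 3).add (W.hasScaledPd_slope hx n j)))).add
      (W.hasScaledPd_div_gap hx hjk four_ne_zero
        ((W.hasScaledPd_slope hx n k).sub (W.hasScaledPd_slope hx n j))))

theorem scaledPd_gamma_diag (W : IsWeb U lam f) {x : Space} (hx : x ∈ U) (n : Fin 3)
    {i j k : Fin 3} (hij : i ≠ j) (hik : i ≠ k) (hjk : j ≠ k) :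
    scaledPd f n (gamma lam f i i i) x =
      dHess f n i i x - (dHess f n i j x + dHess f n i k x) / 2
        + ((dGap lam f n j k x * hirota lam f i j k x + gap lam j k x * dHirota lam f n i j k x)
          / (4 * (gap lam i j x * gap lam k i x))
        - gap lam j k x * hirota lam f i j k x * (dGap lam f n i j x * gap lam k i x
          + gap lam i j x * dGap lam f n k i x) / (4 * (gap lam i j x * gap lam k i x) ^ 2))
        + ((dSlope lam f n i x - dSlope lam f n k x) / (2 * gap lam k i x)
          - (slope lam f i x - slope lam f k x) * dGap lam f n k i x / (2 * gap lam k i x ^ 2))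
        + ((dSlope lam f n j x - dSlope lam f n i x) / (2 * gap lam i j x)
          - (slope lam f j x - slope lam f i x) * dGap lam f n i j x
            / (2 * gap lam i j x ^ 2)) := by
  rw [gamma_diag lam f hij hik hjk]
  exact W.scaledPd_eq hx
    (((((W.hasScaledPd_hess hx n i i).sub
      (((W.hasScaledPd_hess hx n i j).add (W.hasScaledPd_hess hx n i k)).div_const 2)).add
      (W.hasScaledPd_gap_mul_hirota_div hx n hij hik)).add
      (W.hasScaledPd_div_gap hx hik.symm two_ne_zero
        ((W.hasScaledPd_slope hx n i).sub (W.hasScaledPd_slope hx n k)))).add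
      (W.hasScaledPd_div_gap hx hij two_ne_zero
        ((W.hasScaledPd_slope hx n j).sub (W.hasScaledPd_slope hx n i))))

set_option maxHeartbeats 1000000 in
-- The bracket on the left is the symmetrized Ricci tensor on eᵢ and the null vector `gap k i` eᵢ +
-- `gap j k` eⱼ, which g annihilates on the span of eᵢ, eⱼ. Third derivatives of `f` survive only
-- through the derivatives of H along eᵢ and eⱼ.
theorem scaledRicci_relation (W : IsWeb U lam f) {x : Space} (hx : x ∈ U) {i j k : Fin 3}
    (hij : i ≠ j) (hik : i ≠ k) (hjk : j ≠ k) :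
    8 * gap lam k i x * gap lam i j x ^ 2 * (gap lam k i x * scaledRicci lam f i i x
      + gap lam j k x * ((scaledRicci lam f i j x + scaledRicci lam f j i x) / 2))
    = 2 * gap lam j k x * gap lam i j x * (gap lam i j x - gap lam k i x)
          * dHirota lam f j i j k x
      - 2 * gap lam k i x ^ 2 * gap lam i j x * dHirota lam f i i j k x
      + hirota lam f i j k x *
        (gap lam i j x * (gap lam k i x - gap lam i j x) * hirota lam f i j k x
          + gap lam k i x * gap lam i j x ^ 2 * hess f k i x
          + (gap lam j k x - gap lam i j x) * gap lam i j x ^ 2 * hess f i j x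
          + (2 * gap lam j k x + 3 * gap lam i j x)
            * (gap lam j k x * slope lam f i x - gap lam k i x * slope lam f j x)
          - 3 * gap lam i j x ^ 2 * slope lam f k x) := by
  have g1 := W.gap_ne hx hij
  have g2 := W.gap_ne hx hjk
  have g3 := W.gap_ne hx (Ne.symm hik)
  rw [scaledRicci, scaledRicci, scaledRicci]
  simp only [sum_distinct hij hik hjk, gamma_table lam f hij hik hjk,
    gamma_table lam f hjk hij.symm hik.symm, gamma_table lam f hik.symm hjk.symm hij]
  rw [gamma_comm lam f k j i, gamma_comm lam f j i j, gamma_comm lam f i j i]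
  rw [W.scaledPd_gamma_lower hx j hik hij hjk.symm, W.scaledPd_gamma_lower hx k hij hik hjk,
    W.scaledPd_gamma_mixed hx i hij.symm hjk hik,
    W.scaledPd_gamma_mixed hx i hik.symm hjk.symm hij,
    W.scaledPd_gamma_mixed hx j hij.symm hjk hik, W.scaledPd_gamma_mixed hx i hij hik hjk,
    W.scaledPd_gamma_diag hx i hij.symm hjk hik, W.scaledPd_gamma_diag hx j hij hik hjk,
    W.scaledPd_gamma_distinct hx k hik.symm hjk.symm hij,
    W.scaledPd_gamma_mixed hx i hjk.symm hik.symm hij.symm,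
    W.scaledPd_gamma_mixed hx j hik.symm hjk.symm hij]
  simp only [dHirota, hirota, dGap, dHess, dSlope, hij, hik, hjk, hij.symm, hik.symm, hjk.symm,
    ↓reduceIte, hess_comm f k j, hess_comm f i k, hess_comm f j i,
    gap_swap lam k j, gap_swap lam j i, gap_swap lam i k]
  -- Mixed third derivatives are brought to one representative each, so that `ring` sees equal
  -- atoms.
  simp only [hess₃_comm_right f i j i, hess₃_comm_right f i k i, hess₃_comm_right f j k j,
    hess₃_comm_right f j i j, hess₃_comm_right f k j k,
    hess₃_comm_right f i k j, W.hess₃_comm_left hx j i k, W.hess₃_comm_left hx k i j,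
    W.hess₃_comm_left hx j i i, hess₃_comm_right f j k i,
    W.hess₃_comm_left hx i j j]
  have hgap := gap_add lam i j k x
  generalize gap lam i j x = a at *
  generalize gap lam j k x = b at *
  generalize gap lam k i x = c at *
  -- This derivative occurs with both signs in the curvature trace and cancels, so it is never
  -- computed.
  generalize scaledPd f i (gamma lam f i i i) x = d1
  generalize scaledPd f j (gamma lam f j j j) x = d2
  generalize slope lam f i x = p
  generalize slope lam f j x = q
  generalize slope lam f k x = r
  generalize hess f i j x = hij
  generalize hess f j k x = hjk
  generalize hess f k i x = hki
  field_simp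
  subst hgap
  ring

end IsWeb

/-! ### Equivalence of the Einstein–Weyl equation with (A). -/

/-- Adjacent transpositions generate the permutations of three indices. -/
theorem eq_of_swap {α : Type*} {P : Fin 3 → Fin 3 → Fin 3 → α}
    (h₁ : ∀ i j k, i ≠ j → i ≠ k → j ≠ k → P i j k = P j i k)
    (h₂ : ∀ i j k, i ≠ j → i ≠ k → j ≠ k → P i j k = P i k j) {i j k : Fin 3}
    (hij : i ≠ j) (hik : i ≠ k) (hjk : j ≠ k) : P i j k = P 0 1 2 := by
  have a1 : P 0 2 1 = P 0 1 2 := h₂ 0 2 1 (by decide) (by decide) (by decide)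
  have a2 : P 1 0 2 = P 0 1 2 := h₁ 1 0 2 (by decide) (by decide) (by decide)
  have a3 : P 1 2 0 = P 1 0 2 := h₂ 1 2 0 (by decide) (by decide) (by decide)
  have a4 : P 2 0 1 = P 0 2 1 := h₁ 2 0 1 (by decide) (by decide) (by decide)
  have a5 : P 2 1 0 = P 1 2 0 := h₁ 2 1 0 (by decide) (by decide) (by decide)
  fin_cases i <;> fin_cases j <;> fin_cases k <;> simp at hij hik hjk <;>
    simp [a1, a2, a3, a4, a5]

theorem dGap_swap (lam : Fin 3 → ℝ → ℝ) (f : Space → ℝ) (n i j : Fin 3) (x : Space) :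
    dGap lam f n i j x = -dGap lam f n j i x := by
  rw [dGap, dGap, neg_sub]

theorem dHess_comm (f : Space → ℝ) (n i j : Fin 3) (x : Space) :
    dHess f n i j x = dHess f n j i x := by
  rw [dHess, dHess, hess₃_comm_right, hess_comm f i j, add_comm (hess f n i x)]

theorem dHirota_swap (lam : Fin 3 → ℝ → ℝ) (f : Space → ℝ) (n i j k : Fin 3) (x : Space) :
    dHirota lam f n i j k x = -dHirota lam f n j i k x := by
  simp only [dHirota, gap_swap lam k i, gap_swap lam j i, gap_swap lam k j, hess_comm f k i,
    hess_comm f j i, hess_comm f k j, dGap_swap lam f n k i, dGap_swap lam f n j i,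
    dGap_swap lam f n k j, dHess_comm f n k i, dHess_comm f n j i, dHess_comm f n k j]
  ring

theorem dHirota_rotate (lam : Fin 3 → ℝ → ℝ) (f : Space → ℝ) (n i j k : Fin 3) (x : Space) :
    dHirota lam f n i j k x = dHirota lam f n j k i x := by
  simp only [dHirota]; ring

/-- The symmetrization of the scaled Ricci tensor. -/
def symRicci (lam : Fin 3 → ℝ → ℝ) (f : Space → ℝ) (i j : Fin 3) (x : Space) : ℝ :=
  (scaledRicci lam f i j x + scaledRicci lam f j i x) / 2

theorem symRicci_self (lam : Fin 3 → ℝ → ℝ) (f : Space → ℝ) (i : Fin 3) (x : Space) :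
    symRicci lam f i i x = scaledRicci lam f i i x := by
  rw [symRicci]; ring

theorem symRicci_comm (lam : Fin 3 → ℝ → ℝ) (f : Space → ℝ) (i j : Fin 3) (x : Space) :
    symRicci lam f i j x = symRicci lam f j i x := by
  rw [symRicci, symRicci, add_comm]

namespace IsWeb

variable {U : Set Space} {lam : Fin 3 → ℝ → ℝ} {f : Space → ℝ}

theorem ricci_symm (W : IsWeb U lam f) {x : Space} (hx : x ∈ U) (i j : Fin 3) :
    (ricci (webConnection lam f) x i j + ricci (webConnection lam f) x j i) / 2
      = pd i f x * pd j f x * symRicci lam f i j x := by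
  rw [W.ricci_webConnection hx, W.ricci_webConnection hx, symRicci]; ring

/-- The left side of (A) is f₁f₂f₃ times H, and H is alternating, so its vanishing does not depend
on the order of the indices. -/
theorem pdeA_iff_hirota (W : IsWeb U lam f) {x : Space} (hx : x ∈ U) {i j k : Fin 3}
    (hij : i ≠ j) (hik : i ≠ k) (hjk : j ≠ k) : PDEA lam f x ↔ hirota lam f i j k x = 0 := by
  have h : PDEA lam f x ↔ hirota lam f 0 1 2 x = 0 := by
    have h0 := W.pd_ne x hx 0
    have h1 := W.pd_ne x hx 1
    have h2 := W.pd_ne x hx 2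
    have : (lam 1 (x 1) - lam 2 (x 2)) * pd 0 f x * pd 2 (pd 1 f) x
        + (lam 2 (x 2) - lam 0 (x 0)) * pd 1 f x * pd 0 (pd 2 f) x
        + (lam 0 (x 0) - lam 1 (x 1)) * pd 2 f x * pd 1 (pd 0 f) x
        = pd 0 f x * pd 1 f x * pd 2 f x * hirota lam f 0 1 2 x := by
      rw [W.pd_pd hx, W.pd_pd hx, W.pd_pd hx, hirota, gap, gap, gap, hess_comm f 2 1,
        hess_comm f 0 2, hess_comm f 1 0]
      ring
    rw [PDEA, this]
    simp [h0, h1, h2]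
  rw [h, eq_of_swap (P := fun i j k => hirota lam f i j k x = 0) _ _ hij hik hjk]
  · intro i j k _ _ _
    simp only [hirota_swap lam f i j k, neg_eq_zero]
  · intro i j k _ _ _
    simp only [hirota_swap_right lam f i k j, neg_eq_zero]

/-- The trace-free part of the symmetrized Ricci tensor vanishes if the Hirota equation holds. -/
theorem symRicci_relation_of_hirota (W : IsWeb U lam f) (h : ∀ x ∈ U, PDEA lam f x)
    {x : Space} (hx : x ∈ U) {i j k : Fin 3} (hij : i ≠ j) (hik : i ≠ k) (hjk : j ≠ k) :
    gap lam k i x * symRicci lam f i i x + gap lam j k x * symRicci lam f i j x = 0 := by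
  have hz : ∀ y ∈ U, hirota lam f i j k y = 0 := fun y hy =>
    (W.pdeA_iff_hirota hy hij hik hjk).1 (h y hy)
  -- H vanishes on all of the open set, hence so do its first derivatives; (A) at the single point
  -- `x` would not suffice here.
  have hd : ∀ n, dHirota lam f n i j k x = 0 := by
    intro n
    have h1 := (W.hasScaledPd_hirota hx n i j k).2
    rw [pd_congr W.isOpen hz hx, (HasScaledPd.const (f := f) 0).2, mul_zero] at h1
    exact (mul_eq_zero.1 h1.symm).resolve_left (W.pd_ne x hx n)
  have key := W.scaledRicci_relation hx hij hik hjk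
  rw [hz x hx, hd, hd] at key
  simp only [mul_zero, zero_mul, sub_zero, add_zero, mul_eq_zero, OfNat.ofNat_ne_zero, false_or,
    pow_eq_zero_iff two_ne_zero, W.gap_ne hx hij, W.gap_ne hx hik.symm] at key
  rw [symRicci_self]
  exact key

theorem isEinsteinWeyl_of_hirota (W : IsWeb U lam f) (h : ∀ x ∈ U, PDEA lam f x) :
    IsEinsteinWeyl U (webMetric lam f) (webConnection lam f) := by
  -- Λ is read off from the (0,0) component; `hs` shows that the other diagonal components give the
  -- same value.
  refine ⟨fun x => symRicci lam f 0 0 x / gap lam 1 2 x ^ 2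
    * (pd 0 f x * pd 1 f x * pd 2 f x), fun x hx i j => ?_⟩
  beta_reduce
  have hrel : ∀ {i j k : Fin 3}, i ≠ j → i ≠ k → j ≠ k →
      gap lam k i x * symRicci lam f i i x + gap lam j k x * symRicci lam f i j x = 0 :=
    fun hij hik hjk => W.symRicci_relation_of_hirota h hx hij hik hjk
  have hs : ∀ {i j k : Fin 3}, i ≠ j → i ≠ k → j ≠ k →
      symRicci lam f i i x / gap lam j k x ^ 2 = symRicci lam f 0 0 x / gap lam 1 2 x ^ 2 := by
    intro i j k hij hik hjk
    refine eq_of_swap (P := fun i j k => symRicci lam f i i x / gap lam j k x ^ 2) ?_ ?_ hij hik hjk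
    · intro i j k hij hik hjk
      have g1 := W.gap_ne hx hjk
      have g2 := W.gap_ne hx hik
      have r1 := hrel hij hik hjk
      have r2 := hrel hij.symm hjk hik
      rw [symRicci_comm lam f j i, gap_swap lam k j] at r2
      rw [gap_swap lam k i] at r1
      field_simp
      linear_combination (-gap lam i k x) * r1 + gap lam j k x * r2
    · intro i j k _ _ _
      simp only [gap_swap lam j k, neg_sq]
  have hp : ∀ {i j k : Fin 3}, i ≠ j → i ≠ k → j ≠ k →
      pd i f x * pd j f x * pd k f x = pd 0 f x * pd 1 f x * pd 2 f x := by
    intro i j k hij hik hjk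
    refine eq_of_swap (P := fun i j k => pd i f x * pd j f x * pd k f x) ?_ ?_ hij hik hjk <;>
    · intro i j k _ _ _
      ring
  rw [W.ricci_symm hx]
  by_cases hij : i = j
  · subst hij
    obtain ⟨j, k, hij, hik, hjk⟩ := exists_distinct i
    have hj := W.pd_ne x hx j
    have hk := W.pd_ne x hx k
    have g1 := W.gap_ne hx hjk
    rw [← hs hij hik hjk, ← hp hij hik hjk, webMetric_diag lam f hij hik hjk]
    field_simp
  · obtain ⟨k, hik, hjk⟩ := exists_third i j hij
    have hk := W.pd_ne x hx k
    have g1 := W.gap_ne hx hjk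
    have r1 := hrel hij hik hjk
    rw [← hs hij hik hjk, ← hp hij hik hjk, webMetric_offDiag lam f hij hik hjk]
    field_simp
    linear_combination (pd i f x * pd j f x) * r1

/-- This direction is pointwise and algebraic: the derivatives of H at `x` are treated as unknowns
and eliminated. -/
theorem hirota_of_isEinsteinWeyl (W : IsWeb U lam f)
    (h : IsEinsteinWeyl U (webMetric lam f) (webConnection lam f)) {x : Space} (hx : x ∈ U) :
    PDEA lam f x := by
  obtain ⟨Λ, hΛ⟩ := h
  have hrel : ∀ {i j k : Fin 3}, i ≠ j → i ≠ k → j ≠ k →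
      gap lam k i x * scaledRicci lam f i i x + gap lam j k x *
        ((scaledRicci lam f i j x + scaledRicci lam f j i x) / 2) = 0 := by
    intro i j k hij hik hjk
    have hi := W.pd_ne x hx i
    have hj := W.pd_ne x hx j
    have hk := W.pd_ne x hx k
    have h1 := hΛ x hx i i
    have h2 := hΛ x hx i j
    rw [W.ricci_symm hx, webMetric_diag lam f hij hik hjk] at h1
    rw [W.ricci_symm hx, webMetric_offDiag lam f hij hik hjk] at h2
    rw [← symRicci, ← symRicci_self]
    have e1 : symRicci lam f i i x
        = Λ x * gap lam j k x ^ 2 / (pd i f x * pd j f x * pd k f x) := by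
      field_simp at h1 ⊢
      linear_combination h1
    have e2 : symRicci lam f i j x
        = -(Λ x * gap lam k i x * gap lam j k x / (pd i f x * pd j f x * pd k f x)) := by
      field_simp at h2 ⊢
      linear_combination h2
    rw [e1, e2]
    ring
  have h01 : (0 : Fin 3) ≠ 1 := by decide
  have h02 : (0 : Fin 3) ≠ 2 := by decide
  have h12 : (1 : Fin 3) ≠ 2 := by decide
  have E1 := W.scaledRicci_relation hx h01 h02 h12
  have E2 := W.scaledRicci_relation hx h01.symm h12 h02
  have E3 := W.scaledRicci_relation hx h12 h01.symm h02.symm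
  have E4 := W.scaledRicci_relation hx h12.symm h02.symm h01.symm
  have E5 := W.scaledRicci_relation hx h02.symm h12.symm h01
  have E6 := W.scaledRicci_relation hx h02 h01 h12.symm
  rw [hrel h01 h02 h12] at E1
  rw [hrel h01.symm h12 h02] at E2
  rw [hrel h12 h01.symm h02.symm] at E3
  rw [hrel h12.symm h02.symm h01.symm] at E4
  rw [hrel h02.symm h12.symm h01] at E5
  rw [hrel h02 h01 h12.symm] at E6
  have g1 := W.gap_ne hx h01
  have g2 := W.gap_ne hx h12
  have g3 := W.gap_ne hx h02.symm
  have p₁ := hirota_swap lam f 1 0 2 x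
  have p₂ := (hirota_rotate lam f 0 1 2 x).symm
  have p₃ := hirota_swap lam f 2 1 0 x
  have p₄ := hirota_rotate lam f 2 0 1 x
  have p₅ := hirota_swap lam f 0 2 1 x
  have q₁ := fun n => dHirota_swap lam f n 1 0 2 x
  have q₂ := fun n => (dHirota_rotate lam f n 0 1 2 x).symm
  have q₃ := fun n => dHirota_swap lam f n 2 1 0 x
  have q₄ := fun n => dHirota_rotate lam f n 2 0 1 x
  have q₅ := fun n => dHirota_swap lam f n 0 2 1 x
  simp only [p₁, p₂, p₃, p₄, p₅, q₁, q₂, q₃, q₄, q₅, gap_swap lam 2 1, gap_swap lam 1 0,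
    gap_swap lam 0 2, hess_comm f 2 1, hess_comm f 1 0, hess_comm f 0 2] at E1 E2 E3 E4 E5 E6
  have hgap := gap_add lam 0 1 2 x
  have hdef : hirota lam f 0 1 2 x = gap lam 1 2 x * hess f 1 2 x + gap lam 2 0 x * hess f 2 0 x
      + gap lam 0 1 x * hess f 0 1 x := rfl
  rw [W.pdeA_iff_hirota hx h01 h02 h12]
  generalize gap lam 0 1 x = c at *
  generalize gap lam 1 2 x = a at *
  generalize gap lam 2 0 x = b at *
  generalize hirota lam f 0 1 2 x = A at *
  -- The coefficients are chosen so that the derivatives of H cancel, given a + b + c = 0. The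
  -- remaining `hess` terms assemble into H times its own expansion, and `hdef` turns that into A².
  have hA : 8 * (a * b * c) ^ 2 * A ^ 2 = 0 := by
    subst hgap
    linear_combination
      (a ^ 2 * (-c - a) ^ 2 + a ^ 2 * (-c - a) * c) * E1
      + (a ^ 2 * (-c - a) ^ 2 - a ^ 2 * (-c - a) * c) * E2
      + ((-c - a) ^ 2 * c ^ 2 - c ^ 2 * a * (-c - a)) * E3
      + ((-c - a) ^ 2 * c ^ 2 + c ^ 2 * a * (-c - a)) * E4
      + c ^ 2 * a ^ 2 * E5 + c ^ 2 * a ^ 2 * E6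
      + 2 * (a * (-c - a) * c) ^ 2 * A * hdef
  simpa [g1, g2, g3] using hA

theorem isEinsteinWeyl_iff (W : IsWeb U lam f) :
    IsEinsteinWeyl U (webMetric lam f) (webConnection lam f) ↔ ∀ x ∈ U, PDEA lam f x :=
  ⟨fun h _ hx => W.hirota_of_isEinsteinWeyl h hx, W.isEinsteinWeyl_of_hirota⟩

end IsWeb

end WeylGeom

end

theorem mainTheorem7 (U : Set WeylGeom.Space) (hU : IsOpen U)
    (lam : Fin 3 → ℝ → ℝ)
    (hlam : ∀ x ∈ U, ∀ i, ContDiffAt ℝ ∞ (lam i) (x i))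
    (hne : ∀ x ∈ U, ∀ i j, i ≠ j → lam i (x i) ≠ lam j (x j))
    (f : WeylGeom.Space → ℝ) (hf : ContDiffOn ℝ ∞ f U)
    (hf' : ∀ x ∈ U, ∀ i, WeylGeom.pd i f x ≠ 0) :
    WeylGeom.IsMetricOn U (WeylGeom.webMetric lam f) ∧
    WeylGeom.IsOneFormOn U (WeylGeom.webForm lam f) ∧
    ∃ Γ : WeylGeom.Christoffel,
      WeylGeom.IsWeylConnection U (WeylGeom.webMetric lam f) (WeylGeom.webForm lam f) Γ ∧
      (∀ Γ' : WeylGeom.Christoffel,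
        WeylGeom.IsWeylConnection U (WeylGeom.webMetric lam f) (WeylGeom.webForm lam f) Γ' →
          ∀ x ∈ U, Γ' x = Γ x) ∧
      (WeylGeom.IsEinsteinWeyl U (WeylGeom.webMetric lam f) Γ ↔
        ∀ x ∈ U, WeylGeom.PDEA lam f x) := by
  have W : WeylGeom.IsWeb U lam f := ⟨hU, hlam, hne, hf, hf'⟩
  exact ⟨W.isMetricOn, W.isOneFormOn, WeylGeom.webConnection lam f, W.isWeylConnection,
    fun _ hΓ x hx => WeylGeom.IsWeylConnection.unique W.isMetricOn W.isWeylConnection hΓ hx,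
    W.isEinsteinWeyl_iff⟩
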